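/- **Theorem 3.1.** Let $K,L,q$ be integers with $11\le K\le L$ and $q\ge 2$, let $\Lambda=(\mathbb Z/K\mathbb Z)\times(\mathbb Z/L\mathbb Z)$ with the nearest-neighbour relation $\sim$ (periodic boundary conditions), let $S=\{1,\dots,q\}$ be the set of spins with the convention $q+1=1$, and let $\mathcal X=S^\Lambda$. For $\sigma\in\mathcal X$ put $H(\sigma)=\sum_{\{x,y\}\subset\Lambda:\,x\sim y}\mathbf 1\{\sigma(x)\ne\sigma(y)\}$, let $\sigma^{x,a}$ be $\sigma$ with the spin at $x$ updated to $a$, and let $\tau_x\sigma=\sigma^{x,\sigma(x)+1}$. Fix $\beta>0$ and consider the two continuous-time Markov chains on $\mathcal X$ with the following jump rates. * Metropolis–Hastings (MH) dynamics: $r_\beta(\sigma,\zeta)=e^{-\beta\max\{H(\zeta)-H(\sigma),0\}}$ if $\zeta=\sigma^{x,a}\neq\sigma$ for some $x\in\Lambda$, $a\in S$, and $r_\beta(\sigma,\zeta)=0$ otherwise. * Cyclic dynamics: $r_\beta(\sigma,\zeta)=\exp\{-\beta[\max_{a\in S}H(\sigma^{x,a})-H(\sigma)]\}$ if $\zeta=\tau_x\sigma$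 for some $x\in\Lambda$, and $r_\beta(\sigma,\zeta)=0$ otherwise. If $r_\beta(\sigma,\zeta)+r_\beta(\zeta,\sigma)>0$, let $H(\sigma,\zeta)=\max\{H(\sigma),H(\zeta)\}$ for the MH dynamics and $H(\sigma,\zeta)=\max_{a\in S}H(\sigma^{x,a})$, where $\zeta=\tau_x\sigma$ or $\sigma=\tau_x\zeta$, for the cyclic dynamics. A path from $\sigma$ to $\zeta$ is a finite sequence $\omega=(\omega_n)_{n=0}^N$ in $\mathcal X$ with $\omega_0=\sigma$, $\omega_N=\zeta$ and $r_\beta(\omega_n,\omega_{n+1})>0$ for $0\le n<N$; its height is $\Phi_\omega=\max_{0\le n<N}H(\omega_n,\omega_{n+1})$ if $N\ge1$ and $\Phi_\omega=H(\omega_0)$ if $N=0$. Let $\Phi(\sigma,\zeta)=\min_{\omega:\sigma\to\zeta}\Phi_\omega$ be the communication height from $\sigma$ to $\zeta$. For $a\in S$ let $\mathbf a\in\mathcal X$ be the monochromatic configuration with all spins equal to $a$, let $\mathcal S=\{\mathbf a:a\in S\}$, and let $\Gamma_{\mathbf a}=\min_{\mathbf b\in\mathcal S\setminus\{\mathbf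 a\}}\Phi(\mathbf a,\mathbf b)$ be the energy barrier from $\mathbf a$ to the other monochromatic configurations. Then, for all distinct $\mathbf a,\mathbf b\in\mathcal S$, $$\Gamma_{\mathbf a}=\Phi(\mathbf a,\mathbf b)=\begin{cases}2K+2&\text{for the MH dynamics},\\ 2K+4&\text{for the cyclic dynamics, if } q\ge3.\end{cases}$$ In particular, the energy barrier $\Gamma:=\Gamma_{\mathbf a}$ does not depend on $\mathbf a\in\mathcal S$. -/

import Mathlib

namespace PottsMetastability

/-- The nearest-neighbour graph of the discrete torus `𝕋_K × 𝕋_L`, `𝕋_n = ℤ/nℤ`: the box product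
of two cycles (periodic boundary conditions). -/
def torusGraph (K L : ℕ) : SimpleGraph (ZMod K × ZMod L) :=
  SimpleGraph.circulantGraph {(1 : ZMod K)} □ SimpleGraph.circulantGraph {(1 : ZMod L)}

/-- Spin configurations on the torus. The `q` spins are the residue classes modulo `q`, so that
the cyclic convention `q + 1 = 1` is the addition of `ZMod q`. -/
abbrev Config (K L q : ℕ) : Type := ZMod K × ZMod L → ZMod q

section

variable {K L q : ℕ}

/-- The monochromatic configuration in which all spins are `a`. -/
def mono (a : ZMod q) : Config K L q := fun _ => a

/-- The set of all monochromatic configurations (ground states). -/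
def groundStates (K L q : ℕ) : Set (Config K L q) := Set.range mono

/-- `flip σ x a` is `σ^{x,a}`: the spin at `x` is updated to `a`. -/
def flip (σ : Config K L q) (x : ZMod K × ZMod L) (a : ZMod q) : Config K L q :=
  Function.update σ x a

/-- `rotate x σ` is `τ_x σ`: the spin at `x` is rotated to the next one. -/
def rotate (x : ZMod K × ZMod L) (σ : Config K L q) : Config K L q :=
  flip σ x (σ x + 1)

/-- The two dynamics: Metropolis--Hastings and cyclic. -/
inductive Dynamics : Type
  | MH
  | cyc

variable [NeZero K] [NeZero L]

open Classical in
/-- The Hamiltonian: the sum over the unordered pairs `{x, y}` of nearest neighbours of the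
indicator of `σ x ≠ σ y`. It takes values in the natural numbers. -/
noncomputable def hamiltonian (σ : Config K L q) : ℕ :=
  ∑ e ∈ (torusGraph K L).edgeFinset, if (e.map σ).IsDiag then 0 else 1

variable [NeZero q]

/-- `max_{a} H(σ^{x,a})`. -/
noncomputable def maxFlipEnergy (σ : Config K L q) (x : ZMod K × ZMod L) : ℕ :=
  Finset.univ.sup fun a : ZMod q => hamiltonian (flip σ x a)

open Classical in
/-- Jump rates at inverse temperature `β` of the Metropolis--Hastings dynamics. -/
noncomputable def rateMH (β : ℝ) (σ ζ : Config K L q) : ℝ :=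
  if (∃ x a, ζ = flip σ x a) ∧ ζ ≠ σ then
    Real.exp (-β * max ((hamiltonian ζ : ℝ) - (hamiltonian σ : ℝ)) 0)
  else 0

open Classical in
/-- Jump rates at inverse temperature `β` of the cyclic dynamics: the rate is
`exp (-β (max_a H(σ^{x,a}) - H(σ)))` if `ζ = τ_x σ`, and `0` if `ζ` is not of this form.
For `q ≥ 2` there is at most one such `x`, so at most one summand is non-zero. -/
noncomputable def rateCyc (β : ℝ) (σ ζ : Config K L q) : ℝ :=
  ∑ x : ZMod K × ZMod L,
    if ζ = rotate x σ then
      Real.exp (-β * ((maxFlipEnergy σ x : ℝ) - (hamiltonian σ : ℝ)))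
    else 0

/-- Jump rates of the two dynamics. -/
noncomputable def rate : Dynamics → ℝ → Config K L q → Config K L q → ℝ
  | Dynamics.MH => rateMH
  | Dynamics.cyc => rateCyc

open Classical in
/-- The height `H(σ, ζ)` between configurations joined by a jump of the dynamics (in one of the
two directions): `max (H σ) (H ζ)` for the Metropolis--Hastings dynamics, and `max_a H(σ^{x,a})`,
where `x` is the site (unique for `q ≥ 2`) with `ζ = τ_x σ` or `σ = τ_x ζ`, for the cyclic
dynamics. -/
noncomputable def edgeHeight : Dynamics → Config K L q → Config K L q → ℕ
  | Dynamics.MH, σ, ζ => max (hamiltonian σ) (hamiltonian ζ)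
  | Dynamics.cyc, σ, ζ =>
      {x | ζ = rotate x σ ∨ σ = rotate x ζ}.toFinset.sup fun x => maxFlipEnergy σ x

/-- `ω = (ω_n)_{n=0}^N` is a path from `σ` to `ζ`: every step has positive jump rate. -/
structure IsPath (d : Dynamics) (β : ℝ) (σ ζ : Config K L q) (N : ℕ)
    (ω : Fin (N + 1) → Config K L q) : Prop where
  start : ω 0 = σ
  finish : ω (Fin.last N) = ζ
  step : ∀ n : Fin N, 0 < rate d β (ω n.castSucc) (ω n.succ)

/-- The height `Φ_ω` of a path. -/
noncomputable def pathHeight (d : Dynamics) :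
    (N : ℕ) → (Fin (N + 1) → Config K L q) → ℕ
  | 0, ω => hamiltonian (ω 0)
  | N + 1, ω =>
      Finset.univ.sup fun n : Fin (N + 1) => edgeHeight d (ω n.castSucc) (ω n.succ)

/-- The communication height `Φ(σ, ζ)`: the minimum of `Φ_ω` over all paths `ω` from `σ` to `ζ`.
It is taken in `ℕ∞`, where the infimum of a non-empty family of natural numbers is attained, and
would be `⊤` if there were no path at all. -/
noncomputable def commHeight (d : Dynamics) (β : ℝ) (σ ζ : Config K L q) : ℕ∞ :=
  ⨅ (N : ℕ) (ω : Fin (N + 1) → Config K L q) (_ : IsPath d β σ ζ N ω), (pathHeight d N ω : ℕ∞)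

/-- The communication height between two sets of configurations. -/
noncomputable def commHeightSet (d : Dynamics) (β : ℝ) (P Q : Set (Config K L q)) : ℕ∞ :=
  ⨅ σ ∈ P, ⨅ ζ ∈ Q, commHeight d β σ ζ

/-- The energy barrier between the monochromatic configuration `a` and the set of all other
monochromatic configurations. -/
noncomputable def energyBarrier (K L : ℕ) [NeZero K] [NeZero L] (d : Dynamics) (β : ℝ)
    (a : ZMod q) : ℕ∞ :=
  commHeightSet d β {(mono a : Config K L q)} (groundStates K L q \ {mono a})

end

end PottsMetastability

/-! The energy splits into defects along the rows and columns of the torus. A nonconstant cyclic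
word has at least two defects, and at least as many as it has distinct letters.

Lower bounds: a path from `mono a` to `mono b` gains spins `b` at most one at a time, so some step
raises their number from `K * (K / 2) + 1`. This value is decisive for two reasons. It is far from
both `0` and `K * L`, so at energy at most `2 * K + 3` the minority sites cannot be enclosed in
mixed rows and mixed columns. Hence all rows or all columns are mixed, and counting confines the
remaining disorder to one line. Being `1` modulo `K`, the value also forces exactly one `b` on that
line, which therefore is mixed. This is `hasPartialColumn_or_swap`. The crossing lines cost `2 * K`
and the mixed line `2`, which settles Metropolis–Hastings. A cyclic step pays for every spin at the
updated site, and `HasPartialColumn.exists_update_energy_ge` finds one costing two more, provided a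
third spin exists.

Upper bounds: replace `a` by `b` site by site, column by column. Every row has at most two defects
and only the current column is mixed. A third spin at the current site, which the cyclic dynamics
must take into account, adds at most one defect to its row and one to its column
(`lineEnergy_flip_fill_le`). -/

namespace PottsMetastability

open Finset

/-! ### Defects of cyclic words -/

section Cycle

variable {n : ℕ} [NeZero n] {S : Type*} [DecidableEq S]

/-- The number of disagreeing consecutive pairs around a cycle. -/
def cycleDefect (g : ZMod n → S) : ℕ := #{k | g k ≠ g (k + 1)}

theorem exists_defect_eq (g : ZMod n → S) (h : ∃ i j, g i ≠ g j) (i : ZMod n) :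
    ∃ d, g d ≠ g (d + 1) ∧ g d = g i := by
  by_contra! H
  have key : ∀ k : ℕ, g (i + k) = g i := by
    intro k
    induction k with
    | zero => simp
    | succ k ih =>
      by_contra hne
      refine H (i + k) ?_ ih
      rw [ih]
      push_cast at hne
      rw [← add_assoc] at hne
      exact fun h => hne h.symm
  have all : ∀ j, g j = g i := fun j => by
    have := key (j - i).val
    rwa [ZMod.natCast_zmod_val, add_sub_cancel] at this
  obtain ⟨u, v, huv⟩ := h
  exact huv ((all u).trans (all v).symm)

/-- Each spin that occurs in a nonconstant word labels the last site of some arc, and different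
spins give different defects. A constant word has no defect, which is why `1 < #s` is required. -/
theorem card_le_cycleDefect (g : ZMod n → S) (s : Finset S) (hs : 1 < #s)
    (h : ∀ v ∈ s, ∃ i, g i = v) : #s ≤ cycleDefect g := by
  have hg : ∃ i j, g i ≠ g j := by
    obtain ⟨u, hu, v, hv, huv⟩ := Finset.one_lt_card.1 hs
    obtain ⟨i, rfl⟩ := h u hu
    obtain ⟨j, rfl⟩ := h v hv
    exact ⟨i, j, huv⟩
  refine (Finset.card_le_card (t := ({k | g k ≠ g (k + 1)} : Finset (ZMod n)).image g) ?_).trans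
    Finset.card_image_le
  intro v hv
  obtain ⟨i, rfl⟩ := h v hv
  obtain ⟨d, hd, hdi⟩ := exists_defect_eq g hg i
  exact Finset.mem_image.2 ⟨d, by simpa using hd, hdi⟩

theorem two_le_cycleDefect {g : ZMod n → S} {i j : ZMod n} (h : g i ≠ g j) :
    2 ≤ cycleDefect g := by
  have hc : #({g i, g j} : Finset S) = 2 := Finset.card_pair h
  rw [← hc]
  refine card_le_cycleDefect g _ (by omega) ?_
  intro v hv
  simp only [Finset.mem_insert, Finset.mem_singleton] at hv
  rcases hv with rfl | rfl
  exacts [⟨i, rfl⟩, ⟨j, rfl⟩]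

theorem three_le_cycleDefect {g : ZMod n → S} {i j k : ZMod n} (hij : g i ≠ g j)
    (hik : g i ≠ g k) (hjk : g j ≠ g k) : 3 ≤ cycleDefect g := by
  have hc : #({g i, g j, g k} : Finset S) = 3 := Finset.card_eq_three.2 ⟨_, _, _, hij, hik, hjk, rfl⟩
  rw [← hc]
  refine card_le_cycleDefect g _ (by omega) ?_
  intro v hv
  simp only [Finset.mem_insert, Finset.mem_singleton] at hv
  rcases hv with rfl | rfl | rfl
  exacts [⟨i, rfl⟩, ⟨j, rfl⟩, ⟨k, rfl⟩]

theorem cycleDefect_le_of_val {g : ZMod n → S} (T : Finset ℕ)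
    (h : ∀ k : ZMod n, k.val + 1 < n → g k ≠ g (k + 1) → k.val ∈ T) :
    cycleDefect g ≤ #T + 1 := by
  -- The extra position `n - 1` is the seam where the cycle closes up.
  refine (Finset.card_le_card_of_injOn (t := insert (n - 1) T) ZMod.val ?_
    (ZMod.val_injective n).injOn).trans (Finset.card_insert_le _ _)
  intro k hk
  simp only [Finset.coe_filter, Finset.mem_univ, true_and, Set.mem_ofPred_eq] at hk
  simp only [Finset.coe_insert, Set.mem_insert_iff, Finset.mem_coe]
  have := ZMod.val_lt k
  by_cases h' : k.val + 1 < n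
  · exact Or.inr (h k h' hk)
  · left; omega

omit [NeZero n] in
theorem val_add_one_of_succ_lt {k : ZMod n} (h : k.val + 1 < n) : (k + 1).val = k.val + 1 := by
  have h1 : ((1 : ZMod n)).val = 1 := by
    have : Fact (1 < n) := ⟨by omega⟩
    exact ZMod.val_one n
  rw [ZMod.val_add_of_lt (by omega), h1]

/-- A cyclic word of the form `b ⋯ b c a ⋯ a`. -/
theorem cycleDefect_threePhase_le (a b c : S) (m : ℕ) :
    cycleDefect (fun k : ZMod n => if k.val < m then b else if k.val = m then c else a) ≤ 3 := by
  refine (cycleDefect_le_of_val {m - 1, m} ?_).trans (Nat.succ_le_succ Finset.card_le_two)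
  intro k hk hne
  rw [val_add_one_of_succ_lt hk] at hne
  simp only [Finset.mem_insert, Finset.mem_singleton]
  by_contra! hcon
  apply hne
  by_cases h1 : k.val < m
  · rw [if_pos h1, if_pos (by omega)]
  · rw [if_neg h1, if_neg (by omega), if_neg (by omega), if_neg (by omega)]

/-- A cyclic word of the form `b ⋯ b a ⋯ a`. -/
theorem cycleDefect_twoPhase_le (a b : S) (m : ℕ) :
    cycleDefect (fun k : ZMod n => if k.val < m then b else a) ≤ 2 := by
  refine (cycleDefect_le_of_val {m - 1} ?_).trans (by simp)
  intro k hk hne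
  rw [val_add_one_of_succ_lt hk] at hne
  simp only [Finset.mem_singleton]
  by_contra! hcon
  apply hne
  by_cases h1 : k.val < m
  · rw [if_pos h1, if_pos (by omega)]
  · rw [if_neg h1, if_neg (by omega)]

theorem cycleDefect_const (a : S) : cycleDefect (fun _ : ZMod n => a) = 0 := by
  simp [cycleDefect]

end Cycle

/-! ### The Hamiltonian as a sum over rows and columns -/

section Energy

variable {K L : ℕ} [NeZero K] [NeZero L] {S : Type*} [DecidableEq S]

/-- The number of disagreeing nearest-neighbour pairs of the torus, counted line by line. -/
def lineEnergy (σ : ZMod K × ZMod L → S) : ℕ :=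
  ∑ i, cycleDefect (fun j => σ (i, j)) + ∑ j, cycleDefect (fun i => σ (i, j))

theorem lineEnergy_swap (σ : ZMod K × ZMod L → S) : lineEnergy (σ ∘ Prod.swap) = lineEnergy σ := by
  simp only [lineEnergy, Function.comp_apply, Prod.swap_prod_mk]
  exact add_comm _ _

theorem two_ne_zero_of_three_le {n : ℕ} (h : 3 ≤ n) : (2 : ZMod n) ≠ 0 := by
  intro h2
  have h2' : ((2 : ℕ) : ZMod n) = 0 := by exact_mod_cast h2
  rw [ZMod.natCast_eq_zero_iff] at h2'
  exact absurd (Nat.le_of_dvd (by norm_num) h2') (by omega)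

theorem one_ne_zero_of_three_le {n : ℕ} (h : 3 ≤ n) : (1 : ZMod n) ≠ 0 := by
  intro h1
  apply two_ne_zero_of_three_le h
  rw [← one_add_one_eq_two, h1, add_zero]

omit [NeZero K] [NeZero L] in
theorem torusGraph_adj_iff (hK : 3 ≤ K) (hL : 3 ≤ L) (x y : ZMod K × ZMod L) :
    (torusGraph K L).Adj x y ↔
      (y = x + (1, 0) ∨ x = y + (1, 0)) ∨ (y = x + (0, 1) ∨ x = y + (0, 1)) := by
  have h1 := one_ne_zero_of_three_le hK
  have h2 := one_ne_zero_of_three_le hL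
  obtain ⟨x1, x2⟩ := x
  obtain ⟨y1, y2⟩ := y
  simp only [torusGraph, SimpleGraph.boxProd_adj, SimpleGraph.circulantGraph,
    SimpleGraph.fromRel_adj, Set.mem_singleton_iff, Prod.mk_add_mk, Prod.mk.injEq, add_zero,
    sub_eq_iff_eq_add']
  constructor
  · rintro (⟨⟨-, h⟩, h'⟩ | ⟨⟨-, h⟩, h'⟩)
    · left; rcases h with h | h
      · right; exact ⟨h, h'⟩
      · left; exact ⟨h, h'.symm⟩
    · right; rcases h with h | h
      · right; exact ⟨h', h⟩
      · left; exact ⟨h'.symm, h⟩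
  · rintro ((⟨rfl, rfl⟩ | ⟨rfl, rfl⟩) | (⟨rfl, rfl⟩ | ⟨rfl, rfl⟩)) <;> simp [h1, h2]

/-- Each edge is a unit step in one of two directions from a unique base point. Uniqueness needs
side lengths at least `3`: otherwise `2 = 0` could identify a step with its reverse. -/
theorem hamiltonian_eq_lineEnergy {q : ℕ} (hK : 3 ≤ K) (hL : 3 ≤ L) (σ : Config K L q) :
    hamiltonian σ = lineEnergy σ := by
  classical
  have h1 := one_ne_zero_of_three_le hK
  have h2 := one_ne_zero_of_three_le hL
  have h1' := two_ne_zero_of_three_le hK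
  have h2' := two_ne_zero_of_three_le hL
  let v : Bool → ZMod K × ZMod L := fun t => if t then (1, 0) else (0, 1)
  have hsum : hamiltonian σ = ∑ p : Bool × (ZMod K × ZMod L),
      if σ p.2 = σ (p.2 + v p.1) then 0 else 1 := by
    unfold hamiltonian
    symm
    refine Finset.sum_bij (fun p _ => s(p.2, p.2 + v p.1)) ?_ ?_ ?_ ?_
    · rintro ⟨t, x⟩ -
      rw [SimpleGraph.mem_edgeFinset, SimpleGraph.mem_edgeSet, torusGraph_adj_iff hK hL]
      cases t <;> simp [v]
    · rintro ⟨t, x1, x2⟩ - ⟨t', y1, y2⟩ - h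
      have key : ∀ {n : ℕ} (_ : (2 : ZMod n) ≠ 0) (u w : ZMod n), u = w + 1 → u + 1 = w → False := by
        intro n hn u w huw hwu
        apply hn
        rw [huw] at hwu
        linear_combination hwu
      rw [Sym2.eq_iff] at h
      cases t <;> cases t' <;> simp [v] at h ⊢
      · rcases h with h | h
        · tauto
        · exact (key h2' _ _ h.1.2 h.2.2).elim
      · rcases h with h | h
        · exact h2 (by linear_combination h.2.2 - h.1.2)
        · exact h2 (by linear_combination h.2.2 - h.1.2)
      · rcases h with h | h
        · exact h2 (by linear_combination h.1.2 - h.2.2)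
        · exact h2 (by linear_combination h.2.2 - h.1.2)
      · rcases h with h | h
        · tauto
        · exact (key h1' _ _ h.1.1 h.2.1).elim
    · intro e he
      induction e using Sym2.ind with
      | _ x y =>
      rw [SimpleGraph.mem_edgeFinset, SimpleGraph.mem_edgeSet, torusGraph_adj_iff hK hL] at he
      rcases he with (rfl | rfl) | (rfl | rfl)
      · exact ⟨(true, x), Finset.mem_univ _, by simp [v]⟩
      · exact ⟨(true, y), Finset.mem_univ _, by simp [v, Sym2.eq_swap]⟩
      · exact ⟨(false, x), Finset.mem_univ _, by simp [v]⟩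
      · exact ⟨(false, y), Finset.mem_univ _, by simp [v, Sym2.eq_swap]⟩
    · rintro ⟨t, x⟩ -
      simp [Sym2.map_mk]
  rw [hsum, Fintype.sum_prod_type, Fintype.sum_bool, Fintype.sum_prod_type, Fintype.sum_prod_type,
    Finset.sum_comm, add_comm]
  simp only [lineEnergy, cycleDefect, Finset.card_filter, v]
  simp

end Energy

/-! ### Lower bounds at the critical number of spins -/

section LowerBound

variable {S : Type*} [DecidableEq S]

theorem mul_card_add_card_le_sum {ι : Type*} [Fintype ι] [DecidableEq ι] {f : ι → ℕ} {c : ℕ}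
    (T : Finset ι) (h : ∀ i, c ≤ f i) (hT : ∀ i ∈ T, c + 1 ≤ f i) :
    c * Fintype.card ι + #T ≤ ∑ i, f i := by
  have : ∑ i, (c + if i ∈ T then 1 else 0) = c * Fintype.card ι + #T := by
    simp [Finset.sum_add_distrib, mul_comm]
  rw [← this]
  refine Finset.sum_le_sum fun i _ => ?_
  split_ifs with hi
  · exact hT i hi
  · simpa using h i

variable {A B : ℕ} [NeZero A] [NeZero B]

/-- A configuration in which all columns but the `j`-th are monochromatic, with a column of spin
`b`, at least two monochromatic columns of other spins, and at least one site of spin `b` and two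
sites of other spins in the `j`-th column. -/
structure HasPartialColumn (σ : ZMod A × ZMod B → S) (b : S) (j : ZMod B) : Prop where
  full : ∃ p, p ≠ j ∧ ∀ i, σ (i, p) = b
  empty : ∃ p₁ p₂ s₁ s₂, p₁ ≠ p₂ ∧ p₁ ≠ j ∧ p₂ ≠ j ∧ s₁ ≠ b ∧ s₂ ≠ b ∧
    ∀ i, σ (i, p₁) = s₁ ∧ σ (i, p₂) = s₂
  mem : ∃ w, σ (w, j) = b
  const : ∀ p ≠ j, ∀ i i', σ (i, p) = σ (i', p)
  not_mem : ∃ y₁ y₂, y₁ ≠ y₂ ∧ σ (y₁, j) ≠ b ∧ σ (y₂, j) ≠ b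

theorem HasPartialColumn.energy_ge {σ : ZMod A × ZMod B → S} {b : S} {j : ZMod B}
    (h : HasPartialColumn σ b j) : 2 * A + 2 ≤ lineEnergy σ := by
  obtain ⟨p, -, hp⟩ := h.full
  obtain ⟨p₁, p₂, s₁, s₂, -, -, -, hs₁, -, hi⟩ := h.empty
  obtain ⟨w, hw⟩ := h.mem
  obtain ⟨y, -, -, hy, -⟩ := h.not_mem
  refine Nat.add_le_add ?_ ?_
  · have := mul_card_add_card_le_sum (f := fun i => cycleDefect (fun j => σ (i, j))) (c := 2) ∅
      (fun i => two_le_cycleDefect (i := p₁) (j := p) (by rw [hp, (hi i).1]; exact hs₁)) (by simp)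
    simpa [ZMod.card] using this
  · refine le_trans ?_ (Finset.single_le_sum (f := fun j => cycleDefect (fun i => σ (i, j)))
      (fun _ _ => Nat.zero_le _) (Finset.mem_univ j))
    exact two_le_cycleDefect (i := y) (j := w) (by rw [hw]; exact hy)

/-- Updating the spin of any site of spin `≠ b` to a suitable spin costs at least `2`. -/
theorem HasPartialColumn.exists_update_energy_ge {σ : ZMod A × ZMod B → S} {b : S} {j : ZMod B}
    (h : HasPartialColumn σ b j) (hS : ∀ s t : S, ∃ c, c ≠ s ∧ c ≠ t) {x : ZMod A × ZMod B}
    (hx : σ x ≠ b) : ∃ c, 2 * A + 4 ≤ lineEnergy (Function.update σ x c) := by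
  obtain ⟨p, hpj, hp⟩ := h.full
  obtain ⟨p₁, p₂, s₁, s₂, hp₁₂, hp₁j, hp₂j, hs₁, hs₂, hi⟩ := h.empty
  obtain ⟨w, hw⟩ := h.mem
  obtain ⟨y₁, y₂, hy₁₂, hy₁, hy₂⟩ := h.not_mem
  obtain ⟨x₁, x₂⟩ := x
  have off : ∀ c i k, (i ≠ x₁ ∨ k ≠ x₂) → Function.update σ (x₁, x₂) c (i, k) = σ (i, k) := by
    intro c i k hik
    apply Function.update_of_ne
    simp only [ne_eq, Prod.mk.injEq, not_and_or]
    exact hik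
  by_cases hxj : x₂ = j
  · subst hxj
    -- A third spin makes row `x₁` contain `b`, `s₁` and `c`, hence three defects.
    obtain ⟨c, hcb, hcs⟩ := hS b s₁
    obtain ⟨y, hyx, hy⟩ : ∃ y, y ≠ x₁ ∧ σ (y, x₂) ≠ b := by
      by_cases h1 : y₁ = x₁
      · exact ⟨y₂, fun h2 => hy₁₂ (h1.trans h2.symm), hy₂⟩
      · exact ⟨y₁, h1, hy₁⟩
    have hwx : w ≠ x₁ := by rintro rfl; exact hx hw
    refine ⟨c, ?_⟩
    have offη := off c
    set η := Function.update σ (x₁, x₂) c with hη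
    have ηx : η (x₁, x₂) = c := Function.update_self _ _ _
    have ηp : ∀ i, η (i, p) = b := fun i => by rw [offη _ _ (Or.inr hpj), hp]
    have ηp₁ : ∀ i, η (i, p₁) = s₁ := fun i => by rw [offη _ _ (Or.inr hp₁j), (hi i).1]
    have ηw : η (w, x₂) = b := by rw [offη _ _ (Or.inl hwx), hw]
    have ηy : η (y, x₂) = σ (y, x₂) := offη _ _ (Or.inl hyx)
    have row2 : ∀ i, 2 ≤ cycleDefect (fun j => η (i, j)) := fun i =>
      two_le_cycleDefect (i := p₁) (j := p) (by rw [ηp, ηp₁]; exact hs₁)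
    have row3 : 3 ≤ cycleDefect (fun j => η (x₁, j)) :=
      three_le_cycleDefect (i := p₁) (j := p) (k := x₂) (by rw [ηp, ηp₁]; exact hs₁)
        (by rw [ηx, ηp₁]; exact hcs.symm) (by rw [ηx, ηp]; exact hcb.symm)
    have col : cycleDefect (fun i => η (i, x₂)) ≤ ∑ j, cycleDefect (fun i => η (i, j)) :=
      Finset.single_le_sum (f := fun j => cycleDefect (fun i => η (i, j)))
        (fun _ _ => Nat.zero_le _) (Finset.mem_univ x₂)
    unfold lineEnergy
    -- The remaining extra defect comes from row `y` if the spin there is `c`, and otherwise from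
    -- the column, which then shows three spins.
    by_cases hyc : σ (y, x₂) = c
    · have rowy : 3 ≤ cycleDefect (fun j => η (y, j)) :=
        three_le_cycleDefect (i := p₁) (j := p) (k := x₂) (by rw [ηp, ηp₁]; exact hs₁)
          (by rw [ηy, ηp₁, hyc]; exact hcs.symm) (by rw [ηy, ηp, hyc]; exact hcb.symm)
      have rows := mul_card_add_card_le_sum (f := fun i => cycleDefect (fun j => η (i, j))) {x₁, y}
        row2 (by
          intro i hi
          simp only [Finset.mem_insert, Finset.mem_singleton] at hi
          rcases hi with rfl | rfl <;> assumption)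
      rw [Finset.card_pair hyx.symm, ZMod.card] at rows
      have col2 : 2 ≤ cycleDefect (fun i => η (i, x₂)) :=
        two_le_cycleDefect (i := x₁) (j := w) (by rw [ηx, ηw]; exact hcb)
      omega
    · have rows := mul_card_add_card_le_sum (f := fun i => cycleDefect (fun j => η (i, j))) {x₁}
        row2 (by simpa using row3)
      rw [Finset.card_singleton, ZMod.card] at rows
      have col3 : 3 ≤ cycleDefect (fun i => η (i, x₂)) :=
        three_le_cycleDefect (i := x₁) (j := w) (k := y) (by rw [ηx, ηw]; exact hcb)
          (by rw [ηx, ηy]; exact Ne.symm hyc) (by rw [ηw, ηy]; exact hy.symm)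
      omega
  -- Here column `x₂` is monochromatic of a spin other than `b`, so a single `b` creates two defects
  -- in it. The second non-`b` column keeps every row mixed.
  · refine ⟨b, ?_⟩
    have offη := off b
    set η := Function.update σ (x₁, x₂) b with hη
    have ηx : η (x₁, x₂) = b := Function.update_self _ _ _
    have ηp : ∀ i, η (i, p) = b := by
      intro i
      by_cases hpx : p = x₂ ∧ i = x₁
      · rw [hpx.1, hpx.2, ηx]
      · rw [offη _ _ (by tauto), hp]
    obtain ⟨p', hp'x, s', hs', hp'⟩ : ∃ p', p' ≠ x₂ ∧ ∃ s', s' ≠ b ∧ ∀ i, σ (i, p') = s' := by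
      by_cases h1 : p₁ = x₂
      · exact ⟨p₂, fun h2 => hp₁₂ (h1.trans h2.symm), s₂, hs₂, fun i => (hi i).2⟩
      · exact ⟨p₁, h1, s₁, hs₁, fun i => (hi i).1⟩
    have rows := mul_card_add_card_le_sum (f := fun i => cycleDefect (fun j => η (i, j))) (c := 2) ∅
      (fun i => two_le_cycleDefect (i := p') (j := p)
        (by rw [ηp, offη _ _ (Or.inr hp'x), hp']; exact hs')) (by simp)
    rw [Finset.card_empty, ZMod.card] at rows
    have cols : ∑ j ∈ {j, x₂}, cycleDefect (fun i => η (i, j)) ≤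
        ∑ j, cycleDefect (fun i => η (i, j)) :=
      Finset.sum_le_sum_of_subset (Finset.subset_univ _)
    rw [Finset.sum_pair (Ne.symm hxj)] at cols
    have colj : 2 ≤ cycleDefect (fun i => η (i, j)) :=
      two_le_cycleDefect (i := y₁) (j := w) (by
        rw [offη _ _ (Or.inr (Ne.symm hxj)), offη _ _ (Or.inr (Ne.symm hxj)), hw]; exact hy₁)
    obtain ⟨y, hy⟩ : ∃ y, y ≠ x₁ := by
      by_cases h1 : y₁ = x₁
      · exact ⟨y₂, fun h2 => hy₁₂ (h1.trans h2.symm)⟩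
      · exact ⟨y₁, h1⟩
    have colx : 2 ≤ cycleDefect (fun i => η (i, x₂)) :=
      two_le_cycleDefect (i := y) (j := x₁) (by
        rw [offη _ _ (Or.inl hy), ηx, h.const x₂ hxj y x₁]; exact hx)
    unfold lineEnergy
    omega

/-- The number of sites of spin `b`. -/
def spinCount (b : S) (σ : ZMod A × ZMod B → S) : ℕ := #{x | σ x = b}

theorem spinCount_swap (b : S) (σ : ZMod A × ZMod B → S) :
    spinCount b (σ ∘ Prod.swap) = spinCount b σ := by
  simp only [spinCount, Finset.card_filter]
  exact Fintype.sum_equiv (Equiv.prodComm _ _) _ _ (fun x => rfl)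

theorem spinCount_eq_sum (b : S) (σ : ZMod A × ZMod B → S) :
    spinCount b σ = ∑ j, #{i | σ (i, j) = b} := by
  simp only [spinCount, Finset.card_filter]
  rw [Fintype.sum_prod_type, Finset.sum_comm]

theorem dvd_spinCount (b : S) {σ : ZMod A × ZMod B → S}
    (h : ∀ j i i', σ (i, j) = σ (i', j)) : A ∣ spinCount b σ := by
  rw [spinCount_eq_sum]
  refine Finset.dvd_sum fun j _ => ?_
  by_cases hb : σ (0, j) = b
  · simp [h j _ 0, hb, ZMod.card]
  · simp [h j _ 0, hb]

/-- Reduction modulo `A`: the monochromatic columns contribute multiples of `A`, so column `j`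
contains exactly one `b` and exactly `m` other columns are filled with `b`. The bound `m + 3 ≤ B`
leaves two columns of other spins. -/
theorem hasPartialColumn_of_spinCount {b : S} {σ : ZMod A × ZMod B → S} {m : ℕ} (hA : 3 ≤ A)
    (hm : 1 ≤ m) (hmB : m + 3 ≤ B) {j : ZMod B} (h : ∀ p ≠ j, ∀ i i', σ (i, p) = σ (i', p))
    (hb : spinCount b σ = A * m + 1) : HasPartialColumn σ b j := by
  set F : Finset (ZMod B) := {p ∈ univ.erase j | σ (0, p) = b} with hF
  set G : Finset (ZMod B) := {p ∈ univ.erase j | ¬ σ (0, p) = b} with hG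
  set u := #({i | σ (i, j) = b} : Finset (ZMod A)) with hu
  have hFG : #F + #G = B - 1 := by
    rw [hF, hG, Finset.card_filter_add_card_filter_not, Finset.card_erase_of_mem (mem_univ _),
      Finset.card_univ, ZMod.card]
  have hcount : A * #F + u = A * m + 1 := by
    rw [← hb, spinCount_eq_sum, ← Finset.sum_erase_add _ _ (mem_univ j)]
    congr 1
    rw [hF, Finset.card_filter, Finset.mul_sum]
    refine Finset.sum_congr rfl fun p hp => ?_
    have hp' := (Finset.mem_erase.1 hp).1
    by_cases hb : σ (0, p) = b
    · simp [h p hp' _ 0, hb, ZMod.card]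
    · simp [h p hp' _ 0, hb]
  have hcompl : u + #({i | ¬ σ (i, j) = b} : Finset (ZMod A)) = A := by
    rw [hu, Finset.card_filter_add_card_filter_not, Finset.card_univ, ZMod.card]
  have hFm : #F = m := by
    rcases lt_trichotomy (#F) m with hlt | heq | hgt
    · have := Nat.mul_le_mul_left A (Nat.succ_le_of_lt hlt)
      rw [Nat.mul_succ] at this
      omega
    · exact heq
    · have := Nat.mul_le_mul_left A (Nat.succ_le_of_lt hgt)
      rw [Nat.mul_succ] at this
      omega
  rw [hFm] at hcount
  refine ⟨?_, ?_, ?_, h, ?_⟩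
  · obtain ⟨p, hp⟩ := Finset.card_pos.1 (show 0 < #F by omega)
    simp only [hF, Finset.mem_filter, Finset.mem_erase] at hp
    exact ⟨p, hp.1.1, fun i => (h p hp.1.1 i 0).trans hp.2⟩
  · obtain ⟨p₁, h₁, p₂, h₂, h₁₂⟩ := Finset.one_lt_card.1 (show 1 < #G by omega)
    simp only [hG, Finset.mem_filter, Finset.mem_erase] at h₁ h₂
    exact ⟨p₁, p₂, σ (0, p₁), σ (0, p₂), h₁₂, h₁.1.1, h₂.1.1, h₁.2, h₂.2,
      fun i => ⟨h _ h₁.1.1 _ _, h _ h₂.1.1 _ _⟩⟩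
  · obtain ⟨w, hw⟩ := Finset.card_pos.1 (show 0 < u by omega)
    exact ⟨w, by simpa using hw⟩
  · obtain ⟨y₁, h₁, y₂, h₂, h₁₂⟩ := Finset.one_lt_card.1
      (show 1 < #({i | ¬ σ (i, j) = b} : Finset (ZMod A)) by omega)
    exact ⟨y₁, y₂, h₁₂, by simpa using h₁, by simpa using h₂⟩

open Classical in
/-- The set of rows that are not monochromatic. -/
noncomputable def mixedRows (σ : ZMod A × ZMod B → S) : Finset (ZMod A) :=
  {i | ¬ ∀ j j', σ (i, j) = σ (i, j')}

theorem two_mul_card_mixedRows_le (σ : ZMod A × ZMod B → S) :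
    2 * #(mixedRows σ) ≤ ∑ i, cycleDefect (fun j => σ (i, j)) := by
  rw [mul_comm, ← smul_eq_mul]
  refine (Finset.card_nsmul_le_sum _ (fun i => cycleDefect (fun j => σ (i, j))) 2 ?_).trans
    (Finset.sum_le_sum_of_subset (Finset.subset_univ _))
  intro i hi
  simp only [mixedRows, Finset.mem_filter, Finset.mem_univ, true_and] at hi
  push Not at hi
  obtain ⟨j, j', h⟩ := hi
  exact two_le_cycleDefect (i := j) (j := j') h

theorem two_mul_card_mixed_le (σ : ZMod A × ZMod B → S) :
    2 * #(mixedRows σ) + 2 * #(mixedRows (σ ∘ Prod.swap)) ≤ lineEnergy σ :=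
  Nat.add_le_add (two_mul_card_mixedRows_le σ) (two_mul_card_mixedRows_le (σ ∘ Prod.swap))

/-- If there is a monochromatic row and a monochromatic column, then all sites of spin different
from their common spin lie in mixed rows and mixed columns. -/
theorem card_filter_ne_le {σ : ZMod A × ZMod B → S} {i₀ : ZMod A} {j₀ : ZMod B}
    (hi : ∀ j j', σ (i₀, j) = σ (i₀, j')) (hj : ∀ i i', σ (i, j₀) = σ (i', j₀)) :
    #({x | σ x ≠ σ (i₀, j₀)} : Finset (ZMod A × ZMod B)) ≤
      #(mixedRows σ) * #(mixedRows (σ ∘ Prod.swap)) := by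
  rw [← Finset.card_product]
  refine Finset.card_le_card ?_
  rintro ⟨i, j⟩ hx
  simp only [Finset.mem_filter, Finset.mem_univ, true_and] at hx
  simp only [mixedRows, Finset.mem_product, Finset.mem_filter, Finset.mem_univ, true_and,
    Function.comp_apply, Prod.swap_prod_mk]
  exact ⟨fun h => hx ((h j j₀).trans (hj i i₀)), fun h => hx ((h i i₀).trans (hi j j₀))⟩

/-- A monochromatic row and a monochromatic column together would confine either the spins `b` or
all the others to at most `(K + 1) ^ 2 / 4` sites, too few in both cases. So one of the two families
is entirely mixed, and the energy leaves room for at most one mixed line in the other. -/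
theorem hasPartialColumn_or_swap {K L : ℕ} [NeZero K] [NeZero L] (hK : 11 ≤ K) (hKL : K ≤ L)
    {b : S} {σ : ZMod K × ZMod L → S} (hb : spinCount b σ = K * (K / 2) + 1)
    (hE : lineEnergy σ ≤ 2 * K + 3) :
    (∃ j, HasPartialColumn σ b j) ∨ ∃ i, HasPartialColumn (σ ∘ Prod.swap) b i := by
  have hmix := two_mul_card_mixed_le σ
  set m₁ := #(mixedRows σ) with hm₁
  set m₂ := #(mixedRows (σ ∘ Prod.swap)) with hm₂
  -- Parity: the bound `2 * K + 3` gives no more room here than `2 * K + 2`.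
  have hm : m₁ + m₂ ≤ K + 1 := by omega
  have hprod : 4 * (m₁ * m₂) ≤ (K + 1) * (K + 1) := by
    have h1 := Nat.mul_le_mul hm hm
    zify at h1 ⊢
    nlinarith [sq_nonneg ((m₁ : ℤ) - m₂)]
  obtain ⟨m, hmK⟩ : ∃ m, K = 2 * m ∨ K = 2 * m + 1 := ⟨K / 2, by omega⟩
  have hK2 : K / 2 = m := by omega
  rw [hK2] at hb
  by_cases hrow : ∃ i₀, ∀ j j', σ (i₀, j) = σ (i₀, j')
  · by_cases hcol : ∃ j₀, ∀ i i', σ (i, j₀) = σ (i', j₀)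
    · exfalso
      obtain ⟨i₀, hi₀⟩ := hrow
      obtain ⟨j₀, hj₀⟩ := hcol
      have hle := card_filter_ne_le hi₀ hj₀
      have hsplit : spinCount b σ + #({x | ¬ σ x = b} : Finset (ZMod K × ZMod L)) = K * L := by
        rw [spinCount, Finset.card_filter_add_card_filter_not, Finset.card_univ, Fintype.card_prod,
          ZMod.card, ZMod.card]
      by_cases hs : σ (i₀, j₀) = b
      · rw [hs] at hle
        have h3 := Nat.mul_le_mul_left K hKL
        have h4 : #({x | ¬ σ x = b} : Finset (ZMod K × ZMod L)) ≤ m₁ * m₂ := hle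
        rcases hmK with rfl | rfl <;> nlinarith
      · have h4 : spinCount b σ ≤ m₁ * m₂ := by
          refine le_trans (Finset.card_le_card ?_) hle
          intro x hx
          simp only [Finset.mem_filter, Finset.mem_univ, true_and] at hx ⊢
          rw [hx]
          exact Ne.symm hs
        rcases hmK with rfl | rfl <;> nlinarith
    · right
      have hm₂L : m₂ = L := by
        rw [hm₂, mixedRows, Finset.filter_true_of_mem, Finset.card_univ, ZMod.card]
        intro j _ hj
        exact hcol ⟨j, hj⟩
      have hone : m₁ ≤ 1 := by omega
      rcases hKL.eq_or_lt with rfl | hlt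
      · obtain ⟨i, hi⟩ := Finset.card_le_one_iff_subset_singleton.1 hone
        refine ⟨i, hasPartialColumn_of_spinCount (m := m) (by omega) (by omega) (by omega) ?_ ?_⟩
        · intro p hp j j'
          by_contra hne
          refine hp (Finset.mem_singleton.1 (hi ?_))
          simp only [mixedRows, Finset.mem_filter, Finset.mem_univ, true_and]
          exact fun h => hne (h _ _)
        · rw [spinCount_swap, hb]
      -- When `K < L`, mixing all columns is affordable only if `L = K + 1` and every row is
      -- monochromatic. Then `K + 1` would divide `K * m + 1`, which is impossible as `1 < m < K`.
      · exfalso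
        have h0 : mixedRows σ = ∅ := Finset.card_eq_zero.1 (by omega)
        have hdvd : L ∣ spinCount b (σ ∘ Prod.swap) := by
          refine dvd_spinCount b fun i j j' => ?_
          by_contra hne
          have : i ∈ mixedRows σ := by
            simp only [mixedRows, Finset.mem_filter, Finset.mem_univ, true_and]
            exact fun h => hne (h _ _)
          simp [h0] at this
        have hL : L = K + 1 := by omega
        rw [spinCount_swap, hb, hL] at hdvd
        obtain ⟨t, ht⟩ := hdvd
        rcases lt_or_ge t m with h | h
        · have := Nat.mul_le_mul_left (K + 1) (Nat.succ_le_of_lt h)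
          rw [Nat.mul_succ] at this
          have h5 : (K + 1) * m = K * m + m := by ring
          omega
        · have := Nat.mul_le_mul_left (K + 1) h
          have h5 : (K + 1) * m = K * m + m := by ring
          omega
  · left
    have hm₁K : m₁ = K := by
      rw [hm₁, mixedRows, Finset.filter_true_of_mem, Finset.card_univ, ZMod.card]
      intro i _ hi
      exact hrow ⟨i, hi⟩
    have hone : m₂ ≤ 1 := by omega
    obtain ⟨j, hj⟩ := Finset.card_le_one_iff_subset_singleton.1 hone
    refine ⟨j, hasPartialColumn_of_spinCount (m := m) (by omega) (by omega) (by omega) ?_ hb⟩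
    intro p hp i i'
    by_contra hne
    refine hp (Finset.mem_singleton.1 (hj ?_))
    simp only [mixedRows, Finset.mem_filter, Finset.mem_univ, true_and, Function.comp_apply,
      Prod.swap_prod_mk]
    exact fun h => hne (h _ _)

theorem energy_ge_of_spinCount {K L : ℕ} [NeZero K] [NeZero L] (hK : 11 ≤ K) (hKL : K ≤ L)
    {b : S} {σ : ZMod K × ZMod L → S} (hb : spinCount b σ = K * (K / 2) + 1) :
    2 * K + 2 ≤ lineEnergy σ := by
  by_contra! hlt
  rcases hasPartialColumn_or_swap hK hKL hb (by omega) with ⟨j, h⟩ | ⟨i, h⟩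
  · have := h.energy_ge
    omega
  · have := h.energy_ge
    rw [lineEnergy_swap] at this
    omega

theorem exists_update_energy_ge_of_spinCount {K L : ℕ} [NeZero K] [NeZero L] (hK : 11 ≤ K)
    (hKL : K ≤ L) (hS : ∀ s t : S, ∃ c, c ≠ s ∧ c ≠ t) {b : S} {σ : ZMod K × ZMod L → S}
    (hb : spinCount b σ = K * (K / 2) + 1) {x : ZMod K × ZMod L} (hx : σ x ≠ b) :
    ∃ c, 2 * K + 4 ≤ lineEnergy (Function.update σ x c) := by
  by_cases hE : lineEnergy σ ≤ 2 * K + 3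
  · rcases hasPartialColumn_or_swap hK hKL hb hE with ⟨j, h⟩ | ⟨i, h⟩
    · exact h.exists_update_energy_ge hS hx
    · obtain ⟨c, hc⟩ := h.exists_update_energy_ge hS (x := x.swap) (by simpa using hx)
      have hup : Function.update (σ ∘ Prod.swap) x.swap c = Function.update σ x c ∘ Prod.swap := by
        funext y
        simp only [Function.update_apply, Function.comp_apply]
        exact if_congr (by rw [← Prod.swap_inj, Prod.swap_swap]) rfl rfl
      rw [hup, lineEnergy_swap] at hc
      exact ⟨c, by omega⟩
  -- The energy is already high enough, so the current spin serves as witness.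
  · exact ⟨σ x, by rw [Function.update_eq_self]; omega⟩

end LowerBound

/-! ### Paths, heights and the critical step -/

section Paths

variable {K L q : ℕ} [NeZero K] [NeZero L] [NeZero q] {d : Dynamics} {β : ℝ}

/-- Upper bounds can thus be built by chaining moves. The bound on `hamiltonian σ` serves only the
path of length zero, whose height is that energy. -/
theorem commHeight_le_of_reflTransGen {h : ℕ} {σ ζ : Config K L q} (hσ : hamiltonian σ ≤ h)
    (H : Relation.ReflTransGen (fun σ ζ => 0 < rate d β σ ζ ∧ edgeHeight d σ ζ ≤ h) σ ζ) :
    commHeight d β σ ζ ≤ h := by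
  obtain ⟨N, ω, h0, hN, hω⟩ : ∃ (N : ℕ) (ω : ℕ → Config K L q), ω 0 = σ ∧ ω N = ζ ∧
      ∀ n < N, 0 < rate d β (ω n) (ω (n + 1)) ∧ edgeHeight d (ω n) (ω (n + 1)) ≤ h := by
    induction H with
    | refl => exact ⟨0, fun _ => σ, rfl, rfl, by simp⟩
    | @tail η θ _ hstep ih =>
      obtain ⟨N, ω, h0, hN, hω⟩ := ih
      refine ⟨N + 1, fun n => if n ≤ N then ω n else θ, by simpa using h0, by simp, ?_⟩
      intro n hn
      rcases Nat.lt_succ_iff_lt_or_eq.1 hn with hlt | rfl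
      · simpa [hlt.le, Nat.succ_le_of_lt hlt] using hω n hlt
      · simpa [hN] using hstep
  have hpath : IsPath d β σ ζ N fun n : Fin (N + 1) => ω n :=
    ⟨h0, by simpa using hN, fun n => by simpa using (hω n n.2).1⟩
  refine (iInf_le_of_le N (iInf₂_le (fun n : Fin (N + 1) => ω n) hpath)).trans ?_
  rw [Nat.cast_le]
  cases N with
  | zero =>
    change hamiltonian (ω 0) ≤ h
    rwa [h0]
  | succ N => exact Finset.sup_le fun n _ => by simpa using (hω n n.2).2

theorem edgeHeight_le_pathHeight {N : ℕ} (ω : Fin (N + 1) → Config K L q) (n : Fin N) :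
    edgeHeight d (ω n.castSucc) (ω n.succ) ≤ pathHeight d N ω := by
  cases N with
  | zero => exact n.elim0
  | succ N =>
    exact Finset.le_sup (f := fun n : Fin (N + 1) => edgeHeight d (ω n.castSucc) (ω n.succ))
      (Finset.mem_univ n)

theorem exists_rotate_of_rateCyc_pos {σ ζ : Config K L q} (h : 0 < rateCyc β σ ζ) :
    ∃ x, ζ = rotate x σ := by
  by_contra! hne
  simp [rateCyc, hne] at h

theorem rateCyc_rotate_pos (σ : Config K L q) (x : ZMod K × ZMod L) :
    0 < rateCyc β σ (rotate x σ) := by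
  refine Finset.sum_pos' (fun y _ => ?_) ⟨x, Finset.mem_univ x, ?_⟩
  · split_ifs <;> positivity
  · rw [if_pos rfl]; positivity

theorem exists_flip_of_rate_pos {σ ζ : Config K L q} (h : 0 < rate d β σ ζ) :
    ∃ x c, ζ = flip σ x c := by
  cases d with
  | MH =>
    by_contra hne
    simp [rate, rateMH, hne] at h
  | cyc =>
    obtain ⟨x, hx⟩ := exists_rotate_of_rateCyc_pos h
    exact ⟨x, _, hx⟩

omit [NeZero q] in
theorem spinCount_flip_le (σ : Config K L q) (b : ZMod q) (x : ZMod K × ZMod L) (c : ZMod q) :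
    spinCount b (flip σ x c) ≤ spinCount b σ + 1 := by
  refine (Finset.card_le_card ?_).trans (Finset.card_insert_le x _)
  intro y hy
  have hyb : flip σ x c y = b := (Finset.mem_filter.1 hy).2
  rw [Finset.mem_insert]
  by_cases hyx : y = x
  · exact Or.inl hyx
  · rw [flip, Function.update_of_ne hyx] at hyb
    exact Or.inr (Finset.mem_filter.2 ⟨Finset.mem_univ y, hyb⟩)

omit [NeZero q] in
theorem ne_of_spinCount_lt_flip {σ : Config K L q} {b : ZMod q} {x : ZMod K × ZMod L} {c : ZMod q}
    (h : spinCount b σ < spinCount b (flip σ x c)) : σ x ≠ b := by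
  intro hx
  refine h.not_ge (Finset.card_le_card ?_)
  intro y hy
  have hyb : flip σ x c y = b := (Finset.mem_filter.1 hy).2
  refine Finset.mem_filter.2 ⟨Finset.mem_univ y, ?_⟩
  by_cases hyx : y = x
  · rwa [hyx]
  · rwa [flip, Function.update_of_ne hyx] at hyb

theorem exists_step_eq {N n : ℕ} (f : Fin (N + 1) → ℕ) (h0 : f 0 ≤ n) (hN : n < f (Fin.last N))
    (hstep : ∀ k : Fin N, f k.succ ≤ f k.castSucc + 1) :
    ∃ k : Fin N, f k.castSucc = n ∧ f k.succ = n + 1 := by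
  by_contra! hne
  have key : ∀ k, f k ≤ n := fun k => by
    induction k using Fin.induction with
    | zero => exact h0
    | succ k ih =>
      have := hstep k
      have := hne k
      omega
  exact (key _).not_gt hN

/-- Along a path between two ground states, the number of sites of the final spin increases by one
from `K * (K / 2) + 1` at some time. -/
theorem IsPath.exists_critical_step (hK : 11 ≤ K) (hKL : K ≤ L) {a b : ZMod q} (hab : a ≠ b)
    {N : ℕ} {ω : Fin (N + 1) → Config K L q} (h : IsPath d β (mono a) (mono b) N ω) :
    ∃ n : Fin N, spinCount b (ω n.castSucc) = K * (K / 2) + 1 ∧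
      spinCount b (ω n.castSucc) < spinCount b (ω n.succ) := by
  obtain ⟨n, h1, h2⟩ := exists_step_eq (n := K * (K / 2) + 1) (fun k => spinCount b (ω k))
    (by simp [h.start, spinCount, mono, hab])
    (by
      simp only [h.finish, spinCount, mono, Finset.filter_true, Finset.card_univ,
        Fintype.card_prod, ZMod.card]
      have h1 : K / 2 + 1 ≤ L := by omega
      have h2 := Nat.mul_le_mul_left K h1
      rw [Nat.mul_succ] at h2
      omega)
    (fun k => by
      obtain ⟨x, c, hx⟩ := exists_flip_of_rate_pos (h.step k)
      rw [hx]
      exact spinCount_flip_le _ _ _ _)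
  exact ⟨n, h1, by omega⟩

theorem le_commHeight {σ ζ : Config K L q} {h : ℕ}
    (H : ∀ N ω, IsPath d β σ ζ N ω → h ≤ pathHeight d N ω) : (h : ℕ∞) ≤ commHeight d β σ ζ :=
  le_iInf fun N => le_iInf fun ω => le_iInf fun hω => Nat.cast_le.2 (H N ω hω)

theorem le_commHeight_MH (hK : 11 ≤ K) (hKL : K ≤ L) {a b : ZMod q} (hab : a ≠ b) :
    ((2 * K + 2 : ℕ) : ℕ∞) ≤
      commHeight Dynamics.MH β (mono a : Config K L q) (mono b) := by
  refine le_commHeight fun N ω hω => ?_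
  obtain ⟨n, hn, -⟩ := hω.exists_critical_step hK hKL hab
  refine le_trans ?_ (edgeHeight_le_pathHeight ω n)
  refine le_trans ?_ (le_max_left _ _)
  rw [hamiltonian_eq_lineEnergy (by omega) (by omega)]
  exact energy_ge_of_spinCount hK hKL hn

theorem exists_ne_and_ne {q : ℕ} [NeZero q] (hq : 3 ≤ q) (s t : ZMod q) : ∃ c, c ≠ s ∧ c ≠ t := by
  have h : #({s, t} : Finset (ZMod q)) < #(univ : Finset (ZMod q)) := by
    rw [Finset.card_univ, ZMod.card]
    exact Finset.card_le_two.trans_lt hq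
  obtain ⟨c, -, hc⟩ := Finset.exists_mem_notMem_of_card_lt_card h
  simp only [Finset.mem_insert, Finset.mem_singleton, not_or] at hc
  exact ⟨c, hc⟩

theorem le_commHeight_cyc (hK : 11 ≤ K) (hKL : K ≤ L) (hq : 3 ≤ q) {a b : ZMod q} (hab : a ≠ b) :
    ((2 * K + 4 : ℕ) : ℕ∞) ≤
      commHeight Dynamics.cyc β (mono a : Config K L q) (mono b) := by
  classical
  refine le_commHeight fun N ω hω => ?_
  obtain ⟨n, hn, hlt⟩ := hω.exists_critical_step hK hKL hab
  refine le_trans ?_ (edgeHeight_le_pathHeight ω n)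
  obtain ⟨x, hx⟩ := exists_rotate_of_rateCyc_pos (hω.step n)
  rw [hx] at hlt
  obtain ⟨c, hc⟩ := exists_update_energy_ge_of_spinCount hK hKL (exists_ne_and_ne hq) hn
    (ne_of_spinCount_lt_flip hlt)
  rw [← hamiltonian_eq_lineEnergy (by omega) (by omega)] at hc
  refine hc.trans (le_trans ?_ (Finset.le_sup (b := x) ?_))
  · exact Finset.le_sup (f := fun c => hamiltonian (flip (ω n.castSucc) x c)) (Finset.mem_univ c)
  · simp [hx]

/-- For `q ≥ 2` a rotation really changes the spin at its site, so the two configurations determine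
`x`. -/
theorem edgeHeight_rotate_le (hq : 2 ≤ q) (σ : Config K L q) (x : ZMod K × ZMod L) :
    edgeHeight Dynamics.cyc σ (rotate x σ) ≤ maxFlipEnergy σ x := by
  classical
  have : Fact (1 < q) := ⟨hq⟩
  refine Finset.sup_le fun y hy => ?_
  suffices h : y = x by rw [h]
  by_contra hyx
  simp only [Set.mem_toFinset, Set.mem_ofPred_eq] at hy
  rcases hy with h | h
  · have := congrFun h x
    simp [rotate, flip, Function.update_of_ne (Ne.symm hyx)] at this
  · have := congrFun h x
    simp [rotate, flip, Function.update_of_ne (Ne.symm hyx)] at this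

/-- Rotating repeatedly at `x` reaches any spin there, and all these steps have the same bound
because `maxFlipEnergy` does not depend on the current spin at `x`. -/
theorem reflTransGen_flip_cyc (hq : 2 ≤ q) {h : ℕ} (σ : Config K L q) (x : ZMod K × ZMod L)
    (b : ZMod q) (H : ∀ c, hamiltonian (flip σ x c) ≤ h) :
    Relation.ReflTransGen
      (fun σ ζ => 0 < rate Dynamics.cyc β σ ζ ∧ edgeHeight Dynamics.cyc σ ζ ≤ h)
      σ (flip σ x b) := by
  have key : ∀ k : ℕ, Relation.ReflTransGen
      (fun σ ζ => 0 < rate Dynamics.cyc β σ ζ ∧ edgeHeight Dynamics.cyc σ ζ ≤ h)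
      σ (flip σ x (σ x + k)) := by
    intro k
    induction k with
    | zero => simp [flip, Relation.ReflTransGen.refl]
    | succ k ih =>
      refine ih.tail ?_
      have hrot : flip σ x (σ x + (k + 1 : ℕ)) = rotate x (flip σ x (σ x + k)) := by
        simp [rotate, flip, add_assoc]
      rw [hrot]
      refine ⟨rateCyc_rotate_pos _ x, (edgeHeight_rotate_le hq _ x).trans ?_⟩
      refine Finset.sup_le fun c _ => ?_
      have : flip (flip σ x (σ x + k)) x c = flip σ x c := by simp [flip]
      rw [this]
      exact H c
  simpa using key (b - σ x).val

theorem reflTransGen_flip_MH {h : ℕ} (σ : Config K L q) (x : ZMod K × ZMod L) (b : ZMod q)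
    (hσ : hamiltonian σ ≤ h) (hb : hamiltonian (flip σ x b) ≤ h) :
    Relation.ReflTransGen
      (fun σ ζ => 0 < rate Dynamics.MH β σ ζ ∧ edgeHeight Dynamics.MH σ ζ ≤ h)
      σ (flip σ x b) := by
  by_cases hne : flip σ x b = σ
  · rw [hne]
  · refine Relation.ReflTransGen.single ⟨?_, max_le hσ hb⟩
    simp only [rate, rateMH]
    rw [if_pos ⟨⟨x, b, rfl⟩, hne⟩]
    positivity

end Paths

/-! ### Upper bounds by filling column by column -/

section Filling

variable {K L q : ℕ} [NeZero K] [NeZero L]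

/-- The configuration obtained from spin `a` by giving spin `b` to the first `t` sites, where the
sites are enumerated column by column. -/
def fill (a b : ZMod q) (t : ℕ) : Config K L q :=
  fun y => if K * y.2.val + y.1.val < t then b else a

omit [NeZero K] in
theorem mul_add_lt_mul_add_iff {i i' j j' : ℕ} (hi : i < K) (hi' : i' < K) :
    K * j' + i' < K * j + i ↔ j' < j ∨ j' = j ∧ i' < i := by
  rcases lt_trichotomy j' j with h | rfl | h
  · have := Nat.mul_le_mul_left K (Nat.succ_le_of_lt h)
    rw [Nat.mul_succ] at this
    simp only [h, true_or, iff_true]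
    omega
  · simp
  · have := Nat.mul_le_mul_left K (Nat.succ_le_of_lt h)
    rw [Nat.mul_succ] at this
    omega

theorem fill_succ (a b : ZMod q) (x : ZMod K × ZMod L) :
    fill a b (K * x.2.val + x.1.val + 1) = flip (fill a b (K * x.2.val + x.1.val)) x b := by
  funext y
  obtain ⟨y₁, y₂⟩ := y
  obtain ⟨x₁, x₂⟩ := x
  simp only [fill, flip, Function.update_apply, Prod.mk.injEq, Order.lt_add_one_iff]
  have hx := ZMod.val_lt x₁
  have hy := ZMod.val_lt y₁
  by_cases hxy : y₁ = x₁ ∧ y₂ = x₂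
  · obtain ⟨rfl, rfl⟩ := hxy
    simp
  · rw [if_neg hxy]
    refine if_congr (Nat.le_iff_lt_or_eq.trans (or_iff_left fun heq => hxy ?_)) rfl rfl
    have h1 := (mul_add_lt_mul_add_iff (j := x₂.val) (j' := y₂.val) hx hy).not.1 heq.not_lt
    have h2 := (mul_add_lt_mul_add_iff (j := y₂.val) (j' := x₂.val) hy hx).not.1 heq.not_gt
    exact ⟨ZMod.val_injective K (by omega), ZMod.val_injective L (by omega)⟩

theorem lineEnergy_flip_fill_le (a b c : ZMod q) (x : ZMod K × ZMod L) (e : ℕ)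
    (he : ∀ (n : ℕ) [NeZero n] (m : ℕ), cycleDefect
      (fun k : ZMod n => if k.val < m then b else if k.val = m then c else a) ≤ 2 + e) :
    lineEnergy (flip (fill a b (K * x.2.val + x.1.val)) x c) ≤ 2 * K + 2 + 2 * e := by
  obtain ⟨x₁, x₂⟩ := x
  have hx := ZMod.val_lt x₁
  set η : Config K L q := flip (fill a b (K * x₂.val + x₁.val)) (x₁, x₂) c with hη
  have hval : ∀ i j, η (i, j) = if i = x₁ ∧ j = x₂ then c else
      if j.val < x₂.val ∨ j.val = x₂.val ∧ i.val < x₁.val then b else a := by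
    intro i j
    simp only [hη, fill, flip, Function.update_apply, Prod.mk.injEq]
    exact if_congr Iff.rfl rfl
      (if_congr (mul_add_lt_mul_add_iff hx (ZMod.val_lt i)) rfl rfl)
  have hinjK : ∀ i, i = x₁ ↔ i.val = x₁.val := fun i => (ZMod.val_injective K).eq_iff.symm
  have hinjL : ∀ j, j = x₂ ↔ j.val = x₂.val := fun j => (ZMod.val_injective L).eq_iff.symm
  have rows : ∑ i, cycleDefect (fun j => η (i, j)) ≤ 2 * K + e := by
    have hsum : ∑ i : ZMod K, (2 + if i = x₁ then e else 0) = 2 * K + e := by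
      simp [Finset.sum_add_distrib, ZMod.card, mul_comm]
    rw [← hsum]
    refine Finset.sum_le_sum fun i _ => ?_
    by_cases hi : i = x₁
    · rw [if_pos hi]
      refine le_of_eq_of_le (congrArg cycleDefect (funext fun j => ?_)) (he L x₂.val)
      rw [hval]
      simp only [hi, true_and, lt_self_iff_false, and_false, or_false, hinjL]
      split_ifs <;> first | rfl | omega
    · rw [if_neg hi, add_zero]
      refine le_of_eq_of_le (congrArg cycleDefect (funext fun j => ?_))
        -- Rows already visited in the current column have one more site of spin `b`.
        (cycleDefect_twoPhase_le (n := L) a b (if i.val < x₁.val then x₂.val + 1 else x₂.val))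
      rw [hval]
      simp only [hi, false_and, if_false]
      split_ifs <;> first | rfl | omega
  have cols : ∑ j, cycleDefect (fun i => η (i, j)) ≤ 2 + e := by
    rw [Finset.sum_eq_single x₂]
    · refine le_of_eq_of_le (congrArg cycleDefect (funext fun i => ?_)) (he K x₁.val)
      rw [hval]
      simp only [and_true, true_and, lt_self_iff_false, false_or, hinjK]
      split_ifs <;> first | rfl | omega
    · intro j _ hj
      rw [← cycleDefect_const (n := K) (if j.val < x₂.val then b else a)]
      congr 1
      funext i
      rw [hval]
      simp only [hj, and_false, if_false, (hinjL j).not.1 hj, false_and, or_false]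
    · simp
  unfold lineEnergy
  omega

theorem lineEnergy_flip_fill_le_four (a b c : ZMod q) (x : ZMod K × ZMod L) :
    lineEnergy (flip (fill a b (K * x.2.val + x.1.val)) x c) ≤ 2 * K + 4 :=
  lineEnergy_flip_fill_le a b c x 1 fun _ _ m => cycleDefect_threePhase_le a b c m

theorem lineEnergy_flip_fill_le_two {a b c : ZMod q} (hc : c = a ∨ c = b) (x : ZMod K × ZMod L) :
    lineEnergy (flip (fill a b (K * x.2.val + x.1.val)) x c) ≤ 2 * K + 2 := by
  refine lineEnergy_flip_fill_le a b c x 0 fun n _ m => ?_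
  rcases hc with rfl | rfl
  · simpa using cycleDefect_twoPhase_le (n := n) c b m
  · refine le_of_eq_of_le (congrArg cycleDefect (funext fun k => ?_))
      (cycleDefect_twoPhase_le (n := n) a c (m + 1))
    split_ifs <;> first | rfl | omega

omit [NeZero K] [NeZero L] in
theorem flip_fill_self (a b : ZMod q) (x : ZMod K × ZMod L) :
    flip (fill a b (K * x.2.val + x.1.val)) x a = fill a b (K * x.2.val + x.1.val) := by
  unfold flip
  rw [Function.update_eq_self_iff]
  simp [fill]

theorem reflTransGen_mono {r : Config K L q → Config K L q → Prop} (a b : ZMod q)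
    (h : ∀ x : ZMod K × ZMod L, Relation.ReflTransGen r (fill a b (K * x.2.val + x.1.val))
      (flip (fill a b (K * x.2.val + x.1.val)) x b)) :
    Relation.ReflTransGen r (mono a) (mono b) := by
  have key : ∀ t ≤ K * L, Relation.ReflTransGen r (fill a b 0) (fill a b t) := by
    intro t
    induction t with
    | zero => exact fun _ => .refl
    | succ t ih =>
      intro ht
      refine (ih (by omega)).trans ?_
      have hK : (((t % K : ℕ) : ZMod K)).val = t % K :=
        ZMod.val_cast_of_lt (Nat.mod_lt _ (NeZero.pos K))
      have hL : (((t / K : ℕ) : ZMod L)).val = t / K :=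
        ZMod.val_cast_of_lt (Nat.div_lt_of_lt_mul ht)
      -- Division by `K` recovers the site with number `t` in the enumeration.
      have hx := h ((t % K : ℕ), (t / K : ℕ))
      rw [← fill_succ] at hx
      simpa only [hK, hL, Nat.div_add_mod] using hx
  have h0 : (fill a b 0 : Config K L q) = mono a := by
    funext y
    simp [fill, mono]
  have h1 : (fill a b (K * L) : Config K L q) = mono b := by
    funext y
    refine if_pos ?_
    have h1 := ZMod.val_lt y.1
    have h2 := Nat.mul_le_mul_left K (Nat.succ_le_of_lt (ZMod.val_lt y.2))
    rw [Nat.mul_succ] at h2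
    omega
  have := key _ le_rfl
  rwa [h0, h1] at this

theorem hamiltonian_mono (a : ZMod q) : hamiltonian (mono a : Config K L q) = 0 := by
  refine Finset.sum_eq_zero fun e _ => if_pos ?_
  induction e using Sym2.ind with
  | _ x y => simp [mono]

theorem commHeight_MH_le [NeZero q] (hK : 3 ≤ K) (hL : 3 ≤ L) (β : ℝ) (a b : ZMod q) :
    commHeight Dynamics.MH β (mono a : Config K L q) (mono b) ≤ ((2 * K + 2 : ℕ) : ℕ∞) := by
  refine commHeight_le_of_reflTransGen (by simp [hamiltonian_mono]) (reflTransGen_mono a b ?_)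
  intro x
  refine reflTransGen_flip_MH _ x b ?_ ?_
  · rw [← flip_fill_self, hamiltonian_eq_lineEnergy hK hL]
    exact lineEnergy_flip_fill_le_two (Or.inl rfl) x
  · rw [hamiltonian_eq_lineEnergy hK hL]
    exact lineEnergy_flip_fill_le_two (Or.inr rfl) x

theorem commHeight_cyc_le [NeZero q] (hK : 3 ≤ K) (hL : 3 ≤ L) (hq : 2 ≤ q) (β : ℝ)
    (a b : ZMod q) :
    commHeight Dynamics.cyc β (mono a : Config K L q) (mono b) ≤ ((2 * K + 4 : ℕ) : ℕ∞) := by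
  refine commHeight_le_of_reflTransGen (by simp [hamiltonian_mono]) (reflTransGen_mono a b ?_)
  intro x
  refine reflTransGen_flip_cyc hq _ x b fun c => ?_
  rw [hamiltonian_eq_lineEnergy hK hL]
  exact lineEnergy_flip_fill_le_four a b c x

omit [NeZero K] [NeZero L] in
theorem mono_injective : Function.Injective (mono : ZMod q → Config K L q) :=
  fun _ _ h => congrFun h 0

theorem energyBarrier_eq [NeZero q] (hq : 2 ≤ q) {d : Dynamics} {β : ℝ} {h : ℕ∞}
    (H : ∀ a b : ZMod q, a ≠ b → commHeight d β (mono a : Config K L q) (mono b) = h)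
    (a : ZMod q) : energyBarrier K L d β a = h := by
  have : Fact (1 < q) := ⟨hq⟩
  unfold energyBarrier commHeightSet
  rw [_root_.iInf_singleton]
  apply le_antisymm
  · have hne : a ≠ a + 1 := by simp
    rw [← H a (a + 1) hne]
    exact iInf₂_le _ ⟨⟨a + 1, rfl⟩, fun h => hne (mono_injective h).symm⟩
  · refine le_iInf₂ fun ζ hζ => ?_
    obtain ⟨⟨b, rfl⟩, hb⟩ := hζ
    exact (H a b fun hab => hb (by rw [hab]; rfl)).ge

end Filling

end PottsMetastability

theorem theorem3p1 (K L q : ℕ) [NeZero K] [NeZero L] [NeZero q]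
    (hK : 11 ≤ K) (hKL : K ≤ L) (hq : 2 ≤ q) (β : ℝ) (hβ : 0 < β) :
    ((∀ a : ZMod q,
        PottsMetastability.energyBarrier K L PottsMetastability.Dynamics.MH β a =
          ((2 * K + 2 : ℕ) : ℕ∞)) ∧
      (∀ a b : ZMod q, a ≠ b →
        PottsMetastability.commHeight PottsMetastability.Dynamics.MH β
          (PottsMetastability.mono a : PottsMetastability.Config K L q)
          (PottsMetastability.mono b) = ((2 * K + 2 : ℕ) : ℕ∞))) ∧
    (3 ≤ q →
      (∀ a : ZMod q,
        PottsMetastability.energyBarrier K L PottsMetastability.Dynamics.cyc β a =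
          ((2 * K + 4 : ℕ) : ℕ∞)) ∧
      (∀ a b : ZMod q, a ≠ b →
        PottsMetastability.commHeight PottsMetastability.Dynamics.cyc β
          (PottsMetastability.mono a : PottsMetastability.Config K L q)
          (PottsMetastability.mono b) = ((2 * K + 4 : ℕ) : ℕ∞))) := by
  have hMH : ∀ a b : ZMod q, a ≠ b →
      PottsMetastability.commHeight PottsMetastability.Dynamics.MH β
        (PottsMetastability.mono a : PottsMetastability.Config K L q)
        (PottsMetastability.mono b) = ((2 * K + 2 : ℕ) : ℕ∞) := fun a b hab =>
    le_antisymm (PottsMetastability.commHeight_MH_le (by omega) (by omega) β a b)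
      (PottsMetastability.le_commHeight_MH hK hKL hab)
  refine ⟨⟨PottsMetastability.energyBarrier_eq hq hMH, hMH⟩, fun hq3 => ?_⟩
  have hcyc : ∀ a b : ZMod q, a ≠ b →
      PottsMetastability.commHeight PottsMetastability.Dynamics.cyc β
        (PottsMetastability.mono a : PottsMetastability.Config K L q)
        (PottsMetastability.mono b) = ((2 * K + 4 : ℕ) : ℕ∞) := fun a b hab =>
    le_antisymm (PottsMetastability.commHeight_cyc_le (by omega) (by omega) hq β a b)
      (PottsMetastability.le_commHeight_cyc hK hKL hq3 hab)
  exact ⟨PottsMetastability.energyBarrier_eq hq hcyc, hcyc⟩
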